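/- An orientation of a simple graph $G$ is a digraph obtained from $G$ by assigning exactly one direction to every edge of $G$. The diameter of a digraph is the largest of the distances $d(u,v)$ over all ordered pairs of vertices $(u,v)$, where $d(u,v)$ is the minimum length of a directed path from $u$ to $v$, and $d(u,v)=\infty$ if there is no such path. Theorem. Let $n\ge 5$ be an integer. (a) Every simple graph of order $n$ (number of vertices) and size (number of edges) at least $\binom{n}{2}-n+5$ has an orientation of diameter two. (b) Let $G_n$ be the graph obtained from a complete graph on $n-1$ vertices by adding a new vertex $v$ and joining $v$ to exactly three vertices of the complete graph. Then $G_n$ has exactly $\binom{n}{2}-n+4$ edges and has no orientation of diameter two. (c) Consequently the minimum value $m(n)$ such that every simple graph of order $n$ and size at least $m(n)$ has an orientation of diameter two is $m(n)=\binom{n}{2}-n+5$. -/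

import Mathlib

universe u

namespace Digraph

variable {V : Type u}

/-- Directed walks in a digraph. -/
inductive Walk (D : Digraph V) : V → V → Type u
  | nil (v : V) : Walk D v v
  | cons {a b c : V} (h : D.Adj a b) (p : Walk D b c) : Walk D a c

namespace Walk

variable {D : Digraph V}

/-- The number of arcs of a directed walk. -/
def length {a b : V} : Walk D a b → ℕ
  | nil _ => 0
  | cons _ p => p.length + 1

/-- The list of vertices visited by a directed walk, in order. -/
def support {a b : V} : Walk D a b → List V
  | nil v => [v]
  | @cons _ _ a _ _ _ p => a :: p.support

/-- A directed path is a directed walk that repeats no vertex. -/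
def IsPath {a b : V} (p : Walk D a b) : Prop :=
  p.support.Nodup

end Walk

/-- The distance from `a` to `b`: the minimum length of a directed path from `a` to `b`,
and `⊤` if there is no such path. -/
noncomputable def edist (D : Digraph V) (a b : V) : ℕ∞ :=
  ⨅ p : {p : Walk D a b // p.IsPath}, (p.1.length : ℕ∞)

/-- The diameter of a digraph: the largest of the distances between all ordered pairs of
vertices. -/
noncomputable def ediam (D : Digraph V) : ℕ∞ :=
  ⨆ (a : V) (b : V), D.edist a b

/-- `D` is an orientation of `G`: every arc of `D` runs along an edge of `G`, and every edge of
`G` carries exactly one of its two possible directions. -/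
def IsOrientation (D : Digraph V) (G : SimpleGraph V) : Prop :=
  (∀ a b, D.Adj a b → G.Adj a b) ∧ ∀ a b, G.Adj a b → Xor (D.Adj a b) (D.Adj b a)

end Digraph

namespace SimpleGraph

/-- `G` has an orientation whose diameter is exactly two. -/
def HasOrientationOfDiameterTwo {V : Type u} (G : SimpleGraph V) : Prop :=
  ∃ D : Digraph V, D.IsOrientation G ∧ D.ediam = 2

/-- The graph obtained from the complete graph on the vertex set `W` by adding one new vertex
(`none`) and joining it to exactly the vertices in `S`. -/
def completeAddVertex {W : Type u} (S : Finset W) : SimpleGraph (Option W) where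
  Adj
    | some a, some b => a ≠ b
    | none, some b => b ∈ S
    | some a, none => a ∈ S
    | none, none => False
  symm := ⟨by
    rintro (_ | a) (_ | b) h
    · exact h
    · exact h
    · exact h
    · exact Ne.symm h⟩
  loopless := ⟨by
    rintro (_ | a) h
    · exact h
    · exact h rfl⟩

end SimpleGraph

/-!
The proof works with the complement `H` of the graph: `H` has at most `n - 5` edges, and
`SimpleGraph.DiamTwoOn` describes an orientation of the other pairs in which any two vertices are
at most two steps apart. Adding edges to `H` only makes the task harder, so `H` may be taken to
have exactly `n - 5` edges. The induction on `n` removes from `H` a set of vertices that meets at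
least as many edges as it has vertices, orients the rest, and puts the removed vertices back.

* Two leaves of `H` with distinct non-adjacent stems can be removed
  (`SimpleGraph.DiamTwoOn.insert_leaves_of_arc`). The obvious insertion fails only if both leaves
  lie in components with a single edge and the orientation of the rest has the shape
  `v' → Z → v → v'`. Then `Z` itself has diameter two, and a different orientation of the four
  remaining vertices works.
* If there are no such leaves, then the stems of the leaves form a clique, and a degree count
  (`SimpleGraph.four_le_card_isolated`) yields four isolated vertices. Two of them serve as hubs,
  `u₁ → T → u₂ → u₁`, and with their help one vertex of degree at least three or two non-adjacent
  vertices of degree two can be put back in the other direction, `u₂ → W → u₁`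
  (`SimpleGraph.DiamTwoOn.insert_hubs_one`, `SimpleGraph.DiamTwoOn.insert_hubs_two`).
* What remains has degrees at most two, at most three vertices of degree two and at most two leaves,
  hence at most nine vertices, and lies below one of five explicit graphs
  (`SimpleGraph.exists_diamTwoOn_of_irreducible`).

For the extremal graph, a vertex not joined to the new vertex forces the new vertex to have at least
two out-neighbours and, on reversing all arcs, at least two in-neighbours
(`SimpleGraph.exists_two_out_neighbors`), so three neighbours are too few.
-/

/-! ### Inserting vertices into an orientation of diameter two -/

namespace SimpleGraph

variable {V : Type u}

/-- `H.DiamTwoOn T r`: the relation `r` lives on `T`, is asymmetric, avoids the edges of `H`, and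
joins any two distinct vertices of `T` in at most two steps. So `r` is a partial orientation of
the complement of `H`, and its diameter on `T` is at most two. -/
structure DiamTwoOn (H : SimpleGraph V) (T : Set V) (r : V → V → Prop) : Prop where
  mem : ∀ a b, r a b → a ∈ T ∧ b ∈ T
  asymm : ∀ a b, r a b → ¬ r b a
  not_adj : ∀ a b, r a b → ¬ H.Adj a b
  reach : ∀ a b, a ∈ T → b ∈ T → a ≠ b → r a b ∨ ∃ c, r a c ∧ r c b

namespace DiamTwoOn

variable {H : SimpleGraph V} {T : Set V} {r : V → V → Prop}

theorem mono {H' : SimpleGraph V} (h : H.DiamTwoOn T r) (hH : H' ≤ H) : H'.DiamTwoOn T r where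
  mem := h.mem
  asymm := h.asymm
  not_adj a b hab hadj := h.not_adj a b hab (hH hadj)
  reach := h.reach

/-- Orienting the remaining pairs arbitrarily, here along a well-order, keeps the diameter. -/
theorem exists_total (h : H.DiamTwoOn T r) : ∃ r', H.DiamTwoOn T r' ∧
    ∀ a ∈ T, ∀ b ∈ T, a ≠ b → ¬ H.Adj a b → r' a b ∨ r' b a := by
  refine ⟨fun a b => r a b ∨
    (a ∈ T ∧ b ∈ T ∧ ¬ H.Adj a b ∧ ¬ r b a ∧ WellOrderingRel a b), ⟨?_, ?_, ?_, ?_⟩, ?_⟩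
  · have := h.mem
    grind
  · have := h.asymm
    have h' : ∀ a b : V, WellOrderingRel a b → ¬ WellOrderingRel b a :=
      fun a b => asymm_of WellOrderingRel
    grind
  · have := h.not_adj
    grind
  · intro a b ha hb hab
    rcases h.reach a b ha hb hab with h' | ⟨c, h₁, h₂⟩
    · exact Or.inl (Or.inl h')
    · exact Or.inr ⟨c, Or.inl h₁, Or.inl h₂⟩
  · intro a ha b hb hab hadj
    have hadj' : ¬ H.Adj b a := fun h' => hadj h'.symm
    rcases trichotomous_of WellOrderingRel a b with h' | h' | h'
    · grind
    · exact absurd h' hab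
    · grind

/-- If `v → v'` for the stems `v`, `v'` of two leaves `u`, `w` of `H`, and if `v` has an
out-neighbour and `v'` an in-neighbour besides, then `u` and `w` can be inserted: with `R` for the
remaining vertices, `u → R → w → u`, `w → v` and `v' → u`. -/
theorem insert_leaves (h : H.DiamTwoOn T r) {u w v v' x y : V} (hu : u ∉ T) (hw : w ∉ T)
    (huw : u ≠ w) (hT : ∀ a, a ∈ T ∨ a = u ∨ a = w) (huv : ∀ a, H.Adj u a ↔ a = v)
    (hwv : ∀ a, H.Adj w a ↔ a = v') (hvv : r v v') (hx : r v x) (hxv : x ≠ v')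
    (hy : r y v') (hyv : y ≠ v) : ∃ r', H.DiamTwoOn Set.univ r' := by
  have hmem := h.mem
  have hasymm := h.asymm
  have hreach := h.reach
  have hnadj := h.not_adj
  have hsymm : ∀ a b, H.Adj a b → H.Adj b a := fun a b h => h.symm
  obtain ⟨p, hp, hpv⟩ : ∃ p, r p v ∧ p ≠ v' := by
    grind
  obtain ⟨q, hq, hqv⟩ : ∃ q, r v' q ∧ q ≠ v := by
    grind
  refine ⟨fun a b => r a b ∨ (a = u ∧ b ∈ T ∧ b ≠ v ∧ b ≠ v') ∨
    (a ∈ T ∧ a ≠ v ∧ a ≠ v' ∧ b = w) ∨ (a = w ∧ b = u) ∨ (a = w ∧ b = v) ∨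
    (a = v' ∧ b = u), by simp, ?_, ?_, ?_⟩
  · grind
  · grind
  · rintro a b - - hab
    rcases hT a with ha | rfl | rfl <;> rcases hT b with hb | rfl | rfl
    · rcases h.reach a b ha hb hab with h' | ⟨c, h₁, h₂⟩
      · exact Or.inl (Or.inl h')
      · exact Or.inr ⟨c, Or.inl h₁, Or.inl h₂⟩
    · by_cases hav : a = v
      · exact Or.inr ⟨v', by grind, by grind⟩
      · by_cases hav' : a = v'
        · grind
        · exact Or.inr ⟨w, by grind, by grind⟩
    · by_cases hav : a = v
      · exact Or.inr ⟨x, by grind, by grind⟩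
      · by_cases hav' : a = v'
        · exact Or.inr ⟨q, by grind, by grind⟩
        · grind
    · by_cases hbv : b = v
      · exact Or.inr ⟨p, by grind, by grind⟩
      · by_cases hbv' : b = v'
        · exact Or.inr ⟨y, by grind, by grind⟩
        · grind
    · exact absurd rfl hab
    · exact Or.inr ⟨p, by grind, by grind⟩
    · by_cases hbv : b = v
      · grind
      · by_cases hbv' : b = v'
        · exact Or.inr ⟨v, by grind, by grind⟩
        · exact Or.inr ⟨u, by grind, by grind⟩
    · grind
    · exact absurd rfl hab

/-- Two components `{u, v}`, `{w, v'}` of `H` with one edge each can be inserted together.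
Orient the cycle `v → v' → u → w → v` between them; most of `T` receives arcs from `v'`, `w` and
sends arcs to `v`, `u`, and one vertex `s` of `T` does the opposite. -/
theorem insert_two_edges (h : H.DiamTwoOn T r) {u v w v' s t : V}
    (hT : ∀ a, a ∈ T ∨ a = u ∨ a = v ∨ a = w ∨ a = v')
    (huv : u ≠ v) (huw : u ≠ w) (huv' : u ≠ v') (hvw : v ≠ w) (hvv' : v ≠ v') (hwv' : w ≠ v')
    (hu : u ∉ T) (hv : v ∉ T) (hw : w ∉ T) (hv' : v' ∉ T)
    (hHu : ∀ a, H.Adj u a → a = v) (hHv : ∀ a, H.Adj v a → a = u)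
    (hHw : ∀ a, H.Adj w a → a = v') (hHv' : ∀ a, H.Adj v' a → a = w)
    (hs : s ∈ T) (ht : t ∈ T) (hst : s ≠ t) : ∃ r', H.DiamTwoOn Set.univ r' := by
  have hmem := h.mem
  have hasymm := h.asymm
  have hnadj := h.not_adj
  have hsymm : ∀ a b, H.Adj a b → H.Adj b a := fun a b h => h.symm
  refine ⟨fun a b => r a b ∨ (a = v ∧ b = v') ∨ (a = v' ∧ b = u) ∨ (a = u ∧ b = w) ∨
    (a = w ∧ b = v) ∨ (a ∈ T ∧ a ≠ s ∧ (b = v ∨ b = u)) ∨ (b ∈ T ∧ b ≠ s ∧ (a = v' ∨ a = w)) ∨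
    (a = s ∧ (b = v' ∨ b = w)) ∨ (b = s ∧ (a = v ∨ a = u)), by simp, ?_, ?_, ?_⟩
  · grind (splits := 25)
  · grind (splits := 25)
  · rintro a b - - hab
    rcases hT a with ha | rfl | rfl | rfl | rfl
    · rcases hT b with hb | rfl | rfl | rfl | rfl
      · rcases h.reach a b ha hb hab with h' | ⟨c, h₁, h₂⟩
        · exact Or.inl (Or.inl h')
        · exact Or.inr ⟨c, Or.inl h₁, Or.inl h₂⟩
      · by_cases has : a = s
        · exact Or.inr ⟨v', by grind, by grind⟩
        · grind
      · by_cases has : a = s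
        · exact Or.inr ⟨w, by grind, by grind⟩
        · grind
      · by_cases has : a = s
        · grind
        · exact Or.inr ⟨u, by grind, by grind⟩
      · by_cases has : a = s
        · grind
        · exact Or.inr ⟨v, by grind, by grind⟩
    · rcases hT b with hb | rfl | rfl | rfl | rfl
      · by_cases hbs : b = s
        · grind
        · exact Or.inr ⟨w, by grind, by grind⟩
      · exact absurd rfl hab
      · exact Or.inr ⟨w, by grind, by grind⟩
      · grind
      · exact Or.inr ⟨s, by grind, by grind⟩
    · rcases hT b with hb | rfl | rfl | rfl | rfl
      · by_cases hbs : b = s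
        · grind
        · exact Or.inr ⟨v', by grind, by grind⟩
      · exact Or.inr ⟨v', by grind, by grind⟩
      · exact absurd rfl hab
      · exact Or.inr ⟨s, by grind, by grind⟩
      · grind
    · rcases hT b with hb | rfl | rfl | rfl | rfl
      · by_cases hbs : b = s
        · exact Or.inr ⟨v, by grind, by grind⟩
        · grind
      · exact Or.inr ⟨t, by grind, by grind⟩
      · grind
      · exact absurd rfl hab
      · exact Or.inr ⟨v, by grind, by grind⟩
    · rcases hT b with hb | rfl | rfl | rfl | rfl
      · by_cases hbs : b = s
        · exact Or.inr ⟨u, by grind, by grind⟩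
        · grind
      · grind
      · exact Or.inr ⟨t, by grind, by grind⟩
      · exact Or.inr ⟨u, by grind, by grind⟩
      · exact absurd rfl hab

/-- If `v → v'` but `insert_leaves` does not apply, then `v' → T \ {v, v'} → v`. -/
theorem arcs_of_forced (h : H.DiamTwoOn T r) {v v' : V} (hvv : r v v')
    (hforced : (∀ x, r v x → x = v') ∨ ∀ y, r y v' → y = v) :
    ∀ z ∈ T, z ≠ v → z ≠ v' → r v' z ∧ r z v := by
  have hmem := h.mem
  have hasymm := h.asymm
  have hreach := h.reach
  rcases hforced with hf | hf
  · have h1 : ∀ z ∈ T, z ≠ v → z ≠ v' → r v' z := by grind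
    intro z hz hzv hzv'
    refine ⟨h1 z hz hzv hzv', ?_⟩
    rcases hreach z v' hz (hmem _ _ hvv).2 hzv' with h' | ⟨c, h₁, h₂⟩
    · exact absurd h' (hasymm _ _ (h1 z hz hzv hzv'))
    · by_cases hc : c = v
      · exact hc ▸ h₁
      · exact absurd h₂ (hasymm _ _ (h1 c (hmem _ _ h₁).2 hc fun h => hasymm _ _ h₂ (h ▸ h₂)))
  · have h1 : ∀ z ∈ T, z ≠ v → z ≠ v' → r z v := by grind
    intro z hz hzv hzv'
    refine ⟨?_, h1 z hz hzv hzv'⟩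
    rcases hreach v z (hmem _ _ hvv).1 hz (Ne.symm hzv) with h' | ⟨c, h₁, h₂⟩
    · exact absurd h' (hasymm _ _ (h1 z hz hzv hzv'))
    · by_cases hc : c = v'
      · exact hc ▸ h₂
      · exact absurd h₁ (hasymm _ _ (h1 c (hmem _ _ h₁).2 (fun h => hasymm _ _ h₁ (h ▸ h₁)) hc))

/-- Two leaves of `H` whose stems `v`, `v'` are distinct and not adjacent can be inserted, given
`v → v'`. -/
theorem insert_leaves_of_arc (h : H.DiamTwoOn T r) {u w v v' s t : V} (hu : u ∉ T) (hw : w ∉ T)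
    (huw : u ≠ w) (hT : ∀ a, a ∈ T ∨ a = u ∨ a = w) (huv : ∀ a, H.Adj u a ↔ a = v)
    (hwv : ∀ a, H.Adj w a ↔ a = v') (hvv : r v v')
    (hs : s ∈ T) (ht : t ∈ T) (hst : s ≠ t) (hsv : s ≠ v) (hsv' : s ≠ v') (htv : t ≠ v)
    (htv' : t ≠ v') : ∃ r', H.DiamTwoOn Set.univ r' := by
  by_cases hf : (∀ x, r v x → x = v') ∨ ∀ y, r y v' → y = v
  · -- Here `{u, v}` and `{w, v'}` are components of `H`, and `r` restricts to `T \ {v, v'}`.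
    have harcs := h.arcs_of_forced hvv hf
    have hmem := h.mem
    have hasymm := h.asymm
    have hnadj := h.not_adj
    have hZ : H.DiamTwoOn (T \ {v, v'})
        (fun a b => r a b ∧ a ∈ T \ {v, v'} ∧ b ∈ T \ {v, v'}) := by
      refine ⟨by grind, by grind, by grind, ?_⟩
      intro a b ha hb hab
      rcases h.reach a b ha.1 hb.1 hab with h' | ⟨c, h₁, h₂⟩
      · exact Or.inl ⟨h', ha, hb⟩
      · have hc : c ∈ T \ {v, v'} := by
          simp only [Set.mem_sdiff, Set.mem_insert_iff, Set.mem_singleton_iff] at ha hb ⊢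
          grind
        exact Or.inr ⟨c, ⟨h₁, ha, hc⟩, ⟨h₂, hc, hb⟩⟩
    have hT' := hmem _ _ hvv
    have hne : v ≠ v' := fun h => hasymm _ _ hvv (h ▸ hvv)
    have hHv : ∀ a, H.Adj v a → a = u := by
      intro a hva
      rcases hT a with ha | rfl | rfl
      · by_cases hav' : a = v'
        · exact absurd hva (hav' ▸ hnadj _ _ hvv)
        · exact absurd hva.symm (hnadj _ _ (harcs a ha hva.ne' hav').2)
      · rfl
      · exact absurd ((hwv v).1 hva.symm) hne
    have hHv' : ∀ a, H.Adj v' a → a = w := by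
      intro a hva
      rcases hT a with ha | rfl | rfl
      · by_cases hav : a = v
        · exact absurd hva.symm (hav ▸ hnadj _ _ hvv)
        · exact absurd hva (hnadj _ _ (harcs a ha hav hva.ne').1)
      · exact absurd ((huv v').1 hva.symm) hne.symm
      · rfl
    refine hZ.insert_two_edges (u := u) (v := v) (w := w) (v' := v') (s := s) (t := t)
      ?_ ?_ huw ?_ ?_ ?_ ?_ ?_ ?_ ?_ ?_ ?_ ?_ ?_ ?_ ?_ ?_ hst
    all_goals grind
  · push Not at hf
    obtain ⟨⟨x, hx, hxv⟩, y, hy, hyv⟩ := hf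
    exact h.insert_leaves hu hw huw hT huv hwv hvv hx hxv hy hyv

/-- A vertex `w` is inserted together with two isolated vertices `u₁`, `u₂` of `H`, by
`u₁ → T → u₂ → w → u₁`, `u₂ → u₁` and `p → w → q` for two non-neighbours `p`, `q` of `w`. -/
theorem insert_hubs_one (h : H.DiamTwoOn T r) {u₁ u₂ w p q : V} (hu₁ : u₁ ∉ T) (hu₂ : u₂ ∉ T)
    (hw : w ∉ T) (hu : u₁ ≠ u₂) (hu₁w : u₁ ≠ w) (hu₂w : u₂ ≠ w)
    (hT : ∀ a, a ∈ T ∨ a = u₁ ∨ a = u₂ ∨ a = w) (hH₁ : ∀ a, ¬ H.Adj u₁ a)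
    (hH₂ : ∀ a, ¬ H.Adj u₂ a) (hp : p ∈ T) (hq : q ∈ T) (hpq : p ≠ q) (hwp : ¬ H.Adj w p)
    (hwq : ¬ H.Adj w q) : ∃ r', H.DiamTwoOn Set.univ r' := by
  have hmem := h.mem
  have hasymm := h.asymm
  have hnadj := h.not_adj
  have hsymm : ∀ a b, H.Adj a b → H.Adj b a := fun a b h => h.symm
  refine ⟨fun a b => r a b ∨ (a = u₁ ∧ b ∈ T) ∨ (a ∈ T ∧ b = u₂) ∨ (a = u₂ ∧ b = u₁) ∨
    (a = u₂ ∧ b = w) ∨ (a = w ∧ b = u₁) ∨ (a = p ∧ b = w) ∨ (a = w ∧ b = q), by simp, ?_, ?_, ?_⟩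
  · grind (splits := 25)
  · grind (splits := 25)
  · rintro a b - - hab
    rcases hT a with ha | rfl | rfl | rfl <;> rcases hT b with hb | rfl | rfl | rfl
    · rcases h.reach a b ha hb hab with h' | ⟨c, h₁, h₂⟩
      · exact Or.inl (Or.inl h')
      · exact Or.inr ⟨c, Or.inl h₁, Or.inl h₂⟩
    all_goals grind (splits := 25)

/-- Two vertices `w₁`, `w₂` are inserted together with two isolated vertices `u₁`, `u₂` of `H`, by
`u₁ → T → u₂ → {w₁, w₂} → u₁`, `u₂ → u₁` and `w₂ → p → w₁ → q → w₂` for two further isolated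
vertices `p`, `q`. -/
theorem insert_hubs_two (h : H.DiamTwoOn T r) {u₁ u₂ w₁ w₂ p q : V} (hu₁ : u₁ ∉ T) (hu₂ : u₂ ∉ T)
    (hw₁ : w₁ ∉ T) (hw₂ : w₂ ∉ T) (hu : u₁ ≠ u₂) (hw : w₁ ≠ w₂)
    (hu₁w₁ : u₁ ≠ w₁) (hu₂w₁ : u₂ ≠ w₁) (hu₁w₂ : u₁ ≠ w₂) (hu₂w₂ : u₂ ≠ w₂)
    (hT : ∀ a, a ∈ T ∨ a = u₁ ∨ a = u₂ ∨ a = w₁ ∨ a = w₂) (hH₁ : ∀ a, ¬ H.Adj u₁ a)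
    (hH₂ : ∀ a, ¬ H.Adj u₂ a) (hp : p ∈ T) (hq : q ∈ T) (hpq : p ≠ q) (hHp : ∀ a, ¬ H.Adj p a)
    (hHq : ∀ a, ¬ H.Adj q a) : ∃ r', H.DiamTwoOn Set.univ r' := by
  have hmem := h.mem
  have hasymm := h.asymm
  have hnadj := h.not_adj
  have hsymm : ∀ a b, H.Adj a b → H.Adj b a := fun a b h => h.symm
  refine ⟨fun a b => r a b ∨ (a = u₁ ∧ b ∈ T) ∨ (a ∈ T ∧ b = u₂) ∨ (a = u₂ ∧ b = u₁) ∨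
    (a = u₂ ∧ (b = w₁ ∨ b = w₂)) ∨ ((a = w₁ ∨ a = w₂) ∧ b = u₁) ∨ (a = w₂ ∧ b = p) ∨
    (a = p ∧ b = w₁) ∨ (a = w₁ ∧ b = q) ∨ (a = q ∧ b = w₂), by simp, ?_, ?_, ?_⟩
  · grind (splits := 25)
  · grind (splits := 25)
  · rintro a b - - hab
    rcases hT a with ha | rfl | rfl | rfl | rfl <;> rcases hT b with hb | rfl | rfl | rfl | rfl
    · rcases h.reach a b ha hb hab with h' | ⟨c, h₁, h₂⟩
      · exact Or.inl (Or.inl h')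
      · exact Or.inr ⟨c, Or.inl h₁, Or.inl h₂⟩
    all_goals grind (splits := 25)

end DiamTwoOn
end SimpleGraph

/-! ### Counting edges, leaves and isolated vertices -/

namespace SimpleGraph

open Finset

variable {V : Type u}

/-- Each edge in `A` meets the complement of `T`, so it is lost on passing to `T`. -/
theorem ncard_edgeSet_induce_add_le [Finite V] (H : SimpleGraph V) (T : Set V) (A : Set (Sym2 V))
    (hA : A ⊆ H.edgeSet) (hAT : ∀ e ∈ A, ∃ v ∈ e, v ∉ T) :
    (H.induce T).edgeSet.ncard + A.ncard ≤ H.edgeSet.ncard := by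
  have hinj : Function.Injective (Sym2.map (Subtype.val : T → V)) :=
    Sym2.map.injective Subtype.val_injective
  rw [← Set.ncard_image_of_injective _ hinj, ← Set.ncard_union_eq]
  · apply Set.ncard_le_ncard _ (Set.toFinite _)
    rintro e (⟨e', he', rfl⟩ | he)
    · induction e' with
      | _ a b => simpa using he'
    · exact hA he
  · rw [Set.disjoint_left]
    rintro _ ⟨e', -, rfl⟩ he
    obtain ⟨v, hv, hvT⟩ := hAT _ he
    obtain ⟨a, -, rfl⟩ := Sym2.mem_map.1 hv
    exact hvT a.2

theorem DiamTwoOn.of_induce {H : SimpleGraph V} {T : Set V} {r : T → T → Prop}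
    (h : (H.induce T).DiamTwoOn Set.univ r) :
    H.DiamTwoOn T (fun a b => ∃ (ha : a ∈ T) (hb : b ∈ T), r ⟨a, ha⟩ ⟨b, hb⟩) where
  mem := by
    rintro a b ⟨ha, hb, -⟩
    exact ⟨ha, hb⟩
  asymm := by
    rintro a b ⟨ha, hb, h₁⟩ ⟨_, _, h₂⟩
    exact h.asymm _ _ h₁ h₂
  not_adj := by
    rintro a b ⟨ha, hb, h₁⟩ h₂
    exact h.not_adj _ _ h₁ h₂
  reach := by
    intro a b ha hb hab
    rcases h.reach ⟨a, ha⟩ ⟨b, hb⟩ trivial trivial (by simpa using hab) with h' | ⟨c, h₁, h₂⟩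
    · exact Or.inl ⟨ha, hb, h'⟩
    · exact Or.inr ⟨c, ⟨ha, c.2, h₁⟩, ⟨c.2, hb, h₂⟩⟩

theorem exists_le_ncard_edgeSet_eq [Fintype V] (H : SimpleGraph V) {k : ℕ}
    (hk : H.edgeSet.ncard ≤ k) (hk' : k ≤ (Fintype.card V).choose 2) :
    ∃ H', H ≤ H' ∧ H'.edgeSet.ncard = k := by
  classical
  rw [← card_edgeFinset_top_eq_card_choose_two] at hk'
  rw [Set.ncard_eq_toFinset_card'] at hk
  obtain ⟨s, hs, hs', hcard⟩ := exists_subsuperset_card_eq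
    (edgeFinset_mono (le_top : H ≤ ⊤)) hk hk'
  have hdiag : Disjoint (s : Set (Sym2 V)) Sym2.diagSet := by
    rw [Set.disjoint_left]
    intro e he
    have := hs' he
    simpa using this
  refine ⟨fromEdgeSet s, ?_, ?_⟩
  · intro a b hab
    have : s(a, b) ∈ s := hs (by simpa using hab)
    simpa [hab.ne] using this
  · rw [edgeSet_fromEdgeSet, sdiff_eq_left.2 hdiag, Set.ncard_coe_finset, hcard]

section Count

variable [Fintype V] (H : SimpleGraph V) [DecidableRel H.Adj]

theorem sum_degree_eq_leaves_add :
    ∑ v, H.degree v = #{v | H.degree v = 1} + ∑ v with 2 ≤ H.degree v, H.degree v := by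
  rw [card_eq_sum_ones, sum_filter, sum_filter, ← sum_add_distrib]
  refine sum_congr rfl fun v _ => ?_
  split_ifs <;> omega

theorem card_isolated_add_leaves_add :
    #{v | H.degree v = 0} + #{v | H.degree v = 1} + #{v | 2 ≤ H.degree v} = Fintype.card V := by
  rw [← card_univ, card_eq_sum_ones univ, card_filter, card_filter, card_filter,
    ← sum_add_distrib, ← sum_add_distrib]
  refine sum_congr rfl fun v _ => ?_
  split_ifs <;> omega

variable [DecidableEq V]

/-- If the stems of the leaves of `H`, that is, their neighbours, form a clique, then either there
are at most two leaves, or the stems are no leaves and have large total degree. -/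
theorem exists_stems
    (hH : ∀ u w v v', H.degree u = 1 → H.degree w = 1 → H.Adj u v → H.Adj w v' → v ≠ v' →
      H.Adj v v') :
    #{v | H.degree v = 1} ≤ 2 ∨ ∃ M : Finset V, (∀ v ∈ M, 2 ≤ H.degree v) ∧
      #{v | H.degree v = 1} + #M * (#M - 1) ≤ ∑ v ∈ M, H.degree v := by
  have huniq : ∀ u a b, H.degree u = 1 → H.Adj u a → H.Adj u b → a = b := by
    intro u a b hu ha hb
    rw [← card_neighborFinset_eq_degree] at hu
    exact card_le_one.1 hu.le a (by simpa using ha) b (by simpa using hb)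
  by_cases hK : ∃ u w, H.degree u = 1 ∧ H.degree w = 1 ∧ H.Adj u w
  · obtain ⟨u, w, hu, hw, huw⟩ := hK
    left
    refine (card_le_card (t := {u, w}) ?_).trans card_le_two
    intro z hz
    simp only [mem_filter_univ] at hz
    obtain ⟨y, hy⟩ := (H.degree_pos_iff_exists_adj z).1 (by omega)
    by_contra hzuw
    simp only [mem_insert, mem_singleton, not_or] at hzuw
    by_cases hwy : w = y
    · exact hzuw.1 (huniq w z u hw (hwy ▸ hy.symm) huw.symm)
    · have hyu := huniq w y u hw (hH u z w y hu hz huw hy hwy) huw.symm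
      exact hzuw.2 (huniq u z w hu (hyu ▸ hy.symm) huw)
  · right
    set L : Finset V := {v | H.degree v = 1} with hL
    let M : Finset V := {v | ∃ u ∈ L, H.Adj u v}
    have hM : ∀ v ∈ M, H.degree v ≠ 1 := by
      intro v hv hv1
      simp only [M, L, mem_filter_univ] at hv
      obtain ⟨u, hu, huv⟩ := hv
      exact hK ⟨u, v, hu, hv1, huv⟩
    refine ⟨M, fun v hv => ?_, ?_⟩
    · have h1 := hM v hv
      simp only [M, mem_filter_univ] at hv
      obtain ⟨u, -, huv⟩ := hv
      have := (H.degree_pos_iff_exists_adj v).2 ⟨u, huv.symm⟩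
      omega
    · have hcover : L ⊆ M.biUnion fun v => H.neighborFinset v ∩ L := by
        intro u hu
        have hu' : H.degree u = 1 := by simpa [hL] using hu
        obtain ⟨v, hv⟩ := (H.degree_pos_iff_exists_adj u).1 (by omega)
        refine mem_biUnion.2 ⟨v, ?_, ?_⟩
        · simp only [M, mem_filter_univ]
          exact ⟨u, hu, hv⟩
        · simpa [hu] using hv.symm
      have hle : ∀ v ∈ M, #(H.neighborFinset v ∩ L) + (#M - 1) ≤ H.degree v := by
        intro v hv
        rw [← card_erase_of_mem hv, ← card_neighborFinset_eq_degree, ← Finset.card_union_of_disjoint]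
        · apply card_le_card
          apply union_subset inter_subset_left
          intro v' hv'
          obtain ⟨hne, hv'⟩ := mem_erase.1 hv'
          simp only [M, L, mem_filter_univ] at hv hv'
          obtain ⟨u, hu, huv⟩ := hv
          obtain ⟨w, hw, hwv⟩ := hv'
          simpa using hH u w v v' hu hw huv hwv hne.symm
        · rw [Finset.disjoint_left]
          intro x hx hx'
          exact hM x (mem_of_mem_erase hx') (by simpa [hL] using (mem_inter.1 hx).2)
      calc #L + #M * (#M - 1) ≤ ∑ v ∈ M, #(H.neighborFinset v ∩ L) + #M * (#M - 1) := by
            gcongr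
            exact (card_le_card hcover).trans card_biUnion_le
        _ = ∑ v ∈ M, (#(H.neighborFinset v ∩ L) + (#M - 1)) := by
            rw [sum_add_distrib, sum_const, smul_eq_mul]
        _ ≤ _ := sum_le_sum hle

/-- If the stems of the leaves form a clique, a graph with at most `n - 5` edges has at least
four isolated vertices. With `l` leaves and `m` stems, the stems have total degree at least
`l + m * (m - 1)`, so the degree sum bounds the number `i` of isolated vertices by
`2 * i ≥ 10 + m * (m - 3) ≥ 8`. -/
theorem four_le_card_isolated
    (hH : ∀ u w v v', H.degree u = 1 → H.degree w = 1 → H.Adj u v → H.Adj w v' → v ≠ v' →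
      H.Adj v v') (hcard : #H.edgeFinset + 5 ≤ Fintype.card V) :
    4 ≤ #{v | H.degree v = 0} := by
  have h1 := H.sum_degrees_eq_twice_card_edges
  have h2 := H.sum_degree_eq_leaves_add
  have h3 := H.card_isolated_add_leaves_add
  rcases H.exists_stems hH with h | ⟨M, hM, hle⟩
  · have h4 : #{v | 2 ≤ H.degree v} * 2 ≤ ∑ v with 2 ≤ H.degree v, H.degree v := by
      rw [← smul_eq_mul]
      exact card_nsmul_le_sum _ _ _ fun v hv => by simpa using hv
    omega
  · have hsub : M ⊆ ({v | 2 ≤ H.degree v} : Finset V) := fun v hv => by simpa using hM v hv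
    have h4 : #(({v | 2 ≤ H.degree v} : Finset V) \ M) * 2 ≤
        ∑ v ∈ ({v | 2 ≤ H.degree v} : Finset V) \ M, H.degree v := by
      rw [← smul_eq_mul]
      exact card_nsmul_le_sum _ _ _ fun v hv => by simpa using (mem_sdiff.1 hv).1
    rw [← sum_sdiff hsub] at h2
    have h5 := card_sdiff_add_card_eq_card hsub
    have h6 : 3 * #M ≤ #M * (#M - 1) + 2 + #M := by
      rcases Nat.lt_or_ge #M 3 with h | h
      · interval_cases #M <;> omega
      · have : #M * 2 ≤ #M * (#M - 1) := Nat.mul_le_mul_left _ (by omega)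
        omega
    omega

theorem card_leaves_le_two
    (hH : ∀ u w v v', H.degree u = 1 → H.degree w = 1 → H.Adj u v → H.Adj w v' → v ≠ v' →
      H.Adj v v') (hdeg : ∀ v, H.degree v ≤ 2) : #{v | H.degree v = 1} ≤ 2 := by
  rcases H.exists_stems hH with h | ⟨M, hM, hle⟩
  · exact h
  · have h1 : ∑ v ∈ M, H.degree v ≤ #M * 2 := by
      rw [← smul_eq_mul]
      exact sum_le_card_nsmul _ _ _ fun v _ => hdeg v
    rcases Nat.lt_or_ge #M 3 with h | h
    · interval_cases #M <;> omega
    · have : #M * 2 ≤ #M * (#M - 1) := Nat.mul_le_mul_left _ (by omega)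
      omega

end Count
end SimpleGraph

/-! ### Orientations for at most nine vertices -/

namespace SimpleGraph

open Finset

variable {V : Type u}

/-- The graph on `Fin n` with isolated vertices `0, 1, 2, 3`, a triangle `4, 5, 6` and a path
`6, 7, 8, …` starting at it, as far as these vertices are in `Fin n`. -/
def triangleWithTail (n : ℕ) : SimpleGraph (Fin n) where
  Adj i j := i ≠ j ∧ 4 ≤ i.val ∧ 4 ≤ j.val ∧
    ((i.val ≤ 6 ∧ j.val ≤ 6) ∨ i.val + 1 = j.val ∨ j.val + 1 = i.val)
  symm := ⟨fun i j h => ⟨h.1.symm, h.2.2.1, h.2.1, by have := h.2.2.2; omega⟩⟩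
  loopless := ⟨fun i h => h.1 rfl⟩

instance (n : ℕ) : DecidableRel (triangleWithTail n).Adj := fun i j =>
  inferInstanceAs (Decidable (i ≠ j ∧ 4 ≤ i.val ∧ 4 ≤ j.val ∧
    ((i.val ≤ 6 ∧ j.val ≤ 6) ∨ i.val + 1 = j.val ∨ j.val + 1 = i.val)))

/-- Explicit orientations; the binary digits of the `i`-th entry are the out-neighbours of `i`. -/
theorem exists_diamTwoOn_triangleWithTail {n : ℕ} (h5 : 5 ≤ n) (h9 : n ≤ 9) :
    ∃ r, (triangleWithTail n).DiamTwoOn Set.univ r := by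
  suffices H : ∃ f : Fin n → ℕ, (∀ i j : Fin n, (f i).testBit j → ¬ (f j).testBit i) ∧
      (∀ i j : Fin n, (f i).testBit j → ¬ (triangleWithTail n).Adj i j) ∧
      ∀ i j : Fin n, i ≠ j →
        (f i).testBit j ∨ ∃ k : Fin n, (f i).testBit k ∧ (f k).testBit j by
    obtain ⟨f, h₁, h₂, h₃⟩ := H
    exact ⟨fun i j => (f i).testBit j, by simp, h₁, h₂, fun i j _ _ => h₃ i j⟩
  interval_cases n
  · exact ⟨![10, 24, 19, 4, 9], by decide, by decide, by decide⟩
  · exact ⟨![14, 24, 34, 52, 5, 3], by decide, by decide, by decide⟩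
  · exact ⟨![104, 13, 49, 84, 3, 10, 6], by decide, by decide, by decide⟩
  · exact ⟨![84, 49, 170, 99, 140, 129, 6, 11], by decide, by decide, by decide⟩
  · exact ⟨![118, 200, 298, 417, 14, 386, 268, 21, 19], by decide, by decide, by decide⟩

theorem DiamTwoOn.of_equiv {W : Type*} {H : SimpleGraph V} {G : SimpleGraph W} {r : W → W → Prop}
    (h : G.DiamTwoOn Set.univ r) (e : V ≃ W) (hle : ∀ a b, H.Adj a b → G.Adj (e a) (e b)) :
    H.DiamTwoOn Set.univ (fun a b => r (e a) (e b)) where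
  mem := by simp
  asymm a b := h.asymm _ _
  not_adj a b hab hadj := h.not_adj _ _ hab (hle a b hadj)
  reach a b _ _ hab := by
    rcases h.reach (e a) (e b) trivial trivial (e.injective.ne hab) with h' | ⟨c, h₁, h₂⟩
    · exact Or.inl h'
    · exact Or.inr ⟨e.symm c, by simpa using h₁, by simpa using h₂⟩

theorem exists_equiv_fin_lt_four [Fintype V] (A : Finset V) (hA : #A = 4) :
    ∃ e : V ≃ Fin (Fintype.card V), ∀ a, (e a).val < 4 ↔ a ∈ A := by
  classical
  have hle : 4 ≤ Fintype.card V := hA ▸ card_le_univ A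
  have hc : Fintype.card {a // a ∉ A} = Fintype.card V - 4 := by
    rw [Fintype.card_subtype_compl, Fintype.card_coe, hA]
  let e₁ : {a // a ∈ A} ≃ Fin 4 := Fintype.equivFinOfCardEq (by simpa using hA)
  let e₂ : {a // a ∉ A} ≃ Fin (Fintype.card V - 4) := Fintype.equivFinOfCardEq hc
  refine ⟨(Equiv.sumCompl (· ∈ A)).symm.trans ((Equiv.sumCongr e₁ e₂).trans
    (finSumFinEquiv.trans (finCongr (by omega)))), fun a => ?_⟩
  by_cases ha : a ∈ A
  · simp [ha, Equiv.sumCompl_symm_apply_of_pos]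
  · simp [ha, Equiv.sumCompl_symm_apply_of_neg]

/-- The labels of two given vertices outside `A` can be prescribed. -/
theorem exists_equiv_fin_lt_four_of_ne [Fintype V] (A : Finset V) (hA : #A = 4) {x y : V}
    (hx : x ∉ A) (hy : y ∉ A) (hxy : x ≠ y) (i j : Fin (Fintype.card V)) (hi : 4 ≤ i.val)
    (hj : 4 ≤ j.val) (hij : i ≠ j) :
    ∃ e : V ≃ Fin (Fintype.card V), (∀ a, (e a).val < 4 ↔ a ∈ A) ∧ e x = i ∧ e y = j := by
  have swap_lt : ∀ p q k : Fin (Fintype.card V), 4 ≤ p.val → 4 ≤ q.val →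
      ((Equiv.swap p q k).val < 4 ↔ k.val < 4) := by
    intro p q k hp hq
    rw [Equiv.swap_apply_def]
    split_ifs with h₁ h₂
    · subst h₁
      omega
    · subst h₂
      omega
    · rfl
  obtain ⟨e₀, he₀⟩ := exists_equiv_fin_lt_four A hA
  have h4 : ∀ a, a ∉ A → 4 ≤ (e₀ a).val := fun a ha => by
    have := (he₀ a).not.2 ha
    omega
  let e₁ := e₀.trans (Equiv.swap (e₀ x) i)
  have he₁ : ∀ a, (e₁ a).val < 4 ↔ a ∈ A := fun a => by
    rw [← he₀ a]
    exact swap_lt _ _ _ (h4 x hx) hi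
  have h4y : 4 ≤ (e₁ y).val := by
    have := (he₁ y).not.2 hy
    omega
  have hex : e₁ x = i := by simp [e₁]
  refine ⟨e₁.trans (Equiv.swap (e₁ y) j), fun a => ?_, ?_, by simp⟩
  · rw [← he₁ a]
    exact swap_lt _ _ _ h4y hj
  · rw [Equiv.trans_apply, hex]
    exact Equiv.swap_apply_of_ne_of_ne (hex ▸ e₁.injective.ne hxy) hij

/-- The graphs that no reduction applies to have at most nine vertices and embed into
`triangleWithTail`. -/
theorem exists_diamTwoOn_of_irreducible [Fintype V] [DecidableEq V] (H : SimpleGraph V)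
    [DecidableRel H.Adj]
    (hH : ∀ u w v v', H.degree u = 1 → H.degree w = 1 → H.Adj u v → H.Adj w v' → v ≠ v' →
      H.Adj v v') (hdeg : ∀ v, H.degree v ≤ 2)
    (hadj : ∀ v w, H.degree v = 2 → H.degree w = 2 → v ≠ w → H.Adj v w)
    (hcard : #H.edgeFinset + 5 = Fintype.card V) : ∃ r, H.DiamTwoOn Set.univ r := by
  have hI := H.four_le_card_isolated hH hcard.le
  have hL := H.card_leaves_le_two hH hdeg
  have hsum := H.sum_degrees_eq_twice_card_edges
  rw [H.sum_degree_eq_leaves_add] at hsum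
  have hsumD : ∑ v with 2 ≤ H.degree v, H.degree v = #{v | 2 ≤ H.degree v} * 2 := by
    rw [← smul_eq_mul, ← sum_const]
    exact sum_congr rfl fun v hv => le_antisymm (hdeg v) (by simpa using hv)
  have hpart := H.card_isolated_add_leaves_add
  have hD : #{v | 2 ≤ H.degree v} ≤ 3 := by
    rcases Finset.eq_empty_or_nonempty ({v | 2 ≤ H.degree v} : Finset V) with h | ⟨w, hw⟩
    · simp [h]
    · have hw2 : H.degree w = 2 := le_antisymm (hdeg w) (by simpa using hw)
      calc #{v | 2 ≤ H.degree v} ≤ #(insert w (H.neighborFinset w)) := by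
            apply card_le_card
            intro v hv
            have hv2 : H.degree v = 2 := le_antisymm (hdeg v) (by simpa using hv)
            by_cases hvw : v = w
            · simp [hvw]
            · simpa [hvw] using hadj w v hw2 hv2 (Ne.symm hvw)
        _ ≤ _ := by
            refine (card_insert_le _ _).trans ?_
            rw [card_neighborFinset_eq_degree, hw2]
  obtain ⟨A, hAI, hA⟩ := exists_subset_card_eq hI
  have hA0 : ∀ v ∈ A, H.degree v = 0 := fun v hv => by simpa using hAI hv
  have hadjA : ∀ a b, H.Adj a b → a ∉ A ∧ b ∉ A := by
    intro a b hab
    constructor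
    · intro ha
      exact ((H.degree_pos_iff_exists_adj a).2 ⟨b, hab⟩).ne' (hA0 a ha)
    · intro hb
      exact ((H.degree_pos_iff_exists_adj b).2 ⟨a, hab.symm⟩).ne' (hA0 b hb)
  obtain ⟨r, hr⟩ := exists_diamTwoOn_triangleWithTail (n := Fintype.card V) (by omega) (by omega)
  -- It suffices to label the vertices outside `A` so that adjacent labels are adjacent in the tail.
  suffices h : ∃ e : V ≃ Fin (Fintype.card V), (∀ a, (e a).val < 4 ↔ a ∈ A) ∧
      ∀ a b, H.Adj a b → ((e a).val ≤ 6 ∧ (e b).val ≤ 6) ∨ (e a).val + 1 = (e b).val ∨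
        (e b).val + 1 = (e a).val by
    obtain ⟨e, heA, he⟩ := h
    refine ⟨_, hr.of_equiv e fun a b hab => ⟨e.injective.ne hab.ne, ?_, ?_, he a b hab⟩⟩
    · have := (heA a).not.2 (hadjA a b hab).1
      omega
    · have := (heA b).not.2 (hadjA a b hab).2
      omega
  have hcompl : #(univ \ A) = Fintype.card V - 4 := by
    rw [card_sdiff_of_subset (subset_univ A), card_univ, hA]
  have hn : Fintype.card V ≤ 7 ∨ Fintype.card V = 8 ∨ Fintype.card V = 9 := by omega
  rcases hn with hn | hn | hn
  · obtain ⟨e, he⟩ := exists_equiv_fin_lt_four A hA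
    exact ⟨e, he, fun a b _ => Or.inl ⟨by omega, by omega⟩⟩
  · -- A vertex of degree at most one gets the label `7`, its neighbour if any the label `6`.
    obtain ⟨x, hx, hxD⟩ : ∃ x ∈ univ \ A, x ∉ ({v | 2 ≤ H.degree v} : Finset V) :=
      exists_mem_notMem_of_card_lt_card (by omega)
    have hxA : x ∉ A := (mem_sdiff.1 hx).2
    have hx1 : H.degree x ≤ 1 := by
      simp only [mem_filter_univ] at hxD
      omega
    obtain ⟨y, hyA, hyx, hy⟩ : ∃ y, y ∉ A ∧ x ≠ y ∧ ∀ z, H.Adj x z → z = y := by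
      by_cases hxy : ∃ y, H.Adj x y
      · obtain ⟨y, hxy⟩ := hxy
        refine ⟨y, (hadjA x y hxy).2, hxy.ne, fun z hz => ?_⟩
        rw [← card_neighborFinset_eq_degree] at hx1
        exact card_le_one.1 hx1 z (by simpa using hz) y (by simpa using hxy)
      · obtain ⟨y, hy, hyx⟩ := exists_mem_ne (s := univ \ A) (by omega) x
        exact ⟨y, (mem_sdiff.1 hy).2, hyx.symm, fun z hz => absurd ⟨z, hz⟩ hxy⟩
    obtain ⟨e, he, hex, hey⟩ := exists_equiv_fin_lt_four_of_ne A hA hxA hyA hyx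
      ⟨7, by omega⟩ ⟨6, by omega⟩ (by simp) (by simp) (by simp)
    have hlt : ∀ a, a ≠ x → (e a).val ≤ 6 := by
      intro a hax
      have h₁ : (e a).val ≠ 7 := fun h => hax (e.injective (Fin.ext (by rw [h, hex])))
      omega
    refine ⟨e, he, fun a b hab => ?_⟩
    by_cases hax : a = x
    · subst hax
      rw [hy b hab, hex, hey]
      simp
    · by_cases hbx : b = x
      · subst hbx
        rw [hy a hab.symm, hex, hey]
        simp
      · exact Or.inl ⟨hlt a hax, hlt b hbx⟩
  · -- The vertices of degree two form a triangle and the two leaves get the labels `7` and `8`.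
    have hD3 : #{v | 2 ≤ H.degree v} = 3 := by omega
    have hL2 : #{v | H.degree v = 1} = 2 := by omega
    obtain ⟨x, y, hxy, hLxy⟩ := card_eq_two.1 hL2
    have hx1 : H.degree x = 1 := by
      have : x ∈ ({v | H.degree v = 1} : Finset V) := by simp [hLxy]
      simpa using this
    have hy1 : H.degree y = 1 := by
      have : y ∈ ({v | H.degree v = 1} : Finset V) := by simp [hLxy]
      simpa using this
    have hxA : x ∉ A := fun h => by have := hA0 x h; omega
    have hyA : y ∉ A := fun h => by have := hA0 y h; omega
    have hclosed : ∀ a b, H.Adj a b → H.degree a = 2 → H.degree b = 2 := by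
      intro a b hab ha
      by_contra hb
      have haD : a ∈ ({v | 2 ≤ H.degree v} : Finset V) := by simp [ha]
      have hsub : insert b (({v | 2 ≤ H.degree v} : Finset V).erase a) ⊆ H.neighborFinset a := by
        intro c hc
        rcases mem_insert.1 hc with rfl | hc
        · simpa using hab
        · obtain ⟨hca, hc⟩ := mem_erase.1 hc
          have hc2 : H.degree c = 2 := le_antisymm (hdeg c) (by simpa using hc)
          simpa using hadj a c ha hc2 hca.symm
      have hb' : b ∉ ({v | 2 ≤ H.degree v} : Finset V).erase a := by
        intro h
        have : 2 ≤ H.degree b := by simpa using mem_of_mem_erase h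
        exact hb (le_antisymm (hdeg b) this)
      have := card_le_card hsub
      rw [card_insert_of_notMem hb', card_erase_of_mem haD, card_neighborFinset_eq_degree] at this
      omega
    obtain ⟨e, he, hex, hey⟩ := exists_equiv_fin_lt_four_of_ne A hA hxA hyA hxy
      ⟨7, by omega⟩ ⟨8, by omega⟩ (by simp) (by simp) (by simp)
    have hlt : ∀ a, H.degree a = 2 → (e a).val ≤ 6 := by
      intro a ha
      have h₁ : (e a).val ≠ 7 := fun h => by
        have : a = x := e.injective (Fin.ext (by rw [h, hex]))
        subst this
        omega
      have h₂ : (e a).val ≠ 8 := fun h => by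
        have : a = y := e.injective (Fin.ext (by rw [h, hey]))
        subst this
        omega
      omega
    have hleaf : ∀ a b, H.Adj a b → H.degree a ≠ 2 → a = x ∨ a = y := by
      intro a b hab ha
      have h₁ := hdeg a
      have h₂ := (H.degree_pos_iff_exists_adj a).2 ⟨b, hab⟩
      have : a ∈ ({v | H.degree v = 1} : Finset V) := by
        simp only [mem_filter_univ]
        omega
      simpa [hLxy] using this
    refine ⟨e, he, fun a b hab => ?_⟩
    by_cases ha : H.degree a = 2
    · exact Or.inl ⟨hlt a ha, hlt b (hclosed a b hab ha)⟩
    · have hb : H.degree b ≠ 2 := fun hb => ha (hclosed b a hab.symm hb)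
      right
      rcases hleaf a b hab ha with rfl | rfl <;> rcases hleaf b a hab.symm hb with rfl | rfl
      · exact absurd rfl hab.ne
      · rw [hex, hey]
        simp
      · rw [hex, hey]
        simp
      · exact absurd rfl hab.ne

end SimpleGraph

/-! ### The induction -/

namespace SimpleGraph

open Finset

variable {V : Type u}

theorem exists_four_distinct {α : Type*} [DecidableEq α] {s : Finset α} (hs : 4 ≤ #s) :
    ∃ a ∈ s, ∃ b ∈ s, ∃ c ∈ s, ∃ d ∈ s,
      a ≠ b ∧ a ≠ c ∧ a ≠ d ∧ b ≠ c ∧ b ≠ d ∧ c ≠ d := by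
  obtain ⟨a, ha, b, hb, hab⟩ := one_lt_card.1 (show 1 < #s by omega)
  have h2 : #({a, b} : Finset α) = 2 := card_pair hab
  have h3 := le_card_sdiff {a, b} s
  obtain ⟨c, hc, d, hd, hcd⟩ := one_lt_card.1 (show 1 < #(s \ {a, b}) by omega)
  simp only [mem_sdiff, mem_insert, mem_singleton, not_or] at hc hd
  exact ⟨a, ha, b, hb, c, hc.1, d, hd.1, hab, Ne.symm hc.2.1, Ne.symm hd.2.1, Ne.symm hc.2.2,
    Ne.symm hd.2.2, hcd⟩

/-- Deleting a set `R` of vertices that meets at least `#R` edges keeps the number of edges at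
most the number of vertices minus five. -/
theorem exists_diamTwoOn_compl [Fintype V] [DecidableEq V] {H : SimpleGraph V}
    [DecidableRel H.Adj]
    (ih : ∀ (W : Type u) [Fintype W] (G : SimpleGraph W), Fintype.card W < Fintype.card V →
      G.edgeSet.ncard + 5 ≤ Fintype.card W → ∃ r, G.DiamTwoOn Set.univ r)
    (hcard : #H.edgeFinset + 5 ≤ Fintype.card V) (R : Finset V) (hR : R.Nonempty)
    (A : Finset (Sym2 V)) (hA : A ⊆ H.edgeFinset) (hAR : ∀ e ∈ A, ∃ v ∈ e, v ∈ R)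
    (hRA : #R ≤ #A) : ∃ r, H.DiamTwoOn {v | v ∉ R} r := by
  have h1 := H.ncard_edgeSet_induce_add_le {v | v ∉ R} A (by simpa using coe_subset.2 hA)
    fun e he => by simpa using hAR e he
  have hE : H.edgeSet.ncard = #H.edgeFinset := Set.ncard_eq_toFinset_card' _
  rw [Set.ncard_coe_finset, hE] at h1
  have h2 : Fintype.card {v | v ∉ R} = Fintype.card V - #R := by
    rw [← card_compl, ← Fintype.card_coe]
    exact Fintype.card_congr (Equiv.subtypeEquivRight fun v => by simp)
  have h3 := hR.card_pos
  have h4 := card_le_univ R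
  have h5 : Fintype.card {v | v ∉ R} < Fintype.card V := by omega
  obtain ⟨r, hr⟩ := ih {v | v ∉ R} (H.induce {v | v ∉ R}) h5 (by omega)
  exact ⟨_, hr.of_induce⟩

/-- A graph on `n` vertices whose complement `H` has at most `n - 5` edges has an orientation of
diameter at most two. -/
theorem exists_diamTwoOn_of_ncard_edgeSet_le [Fintype V] (H : SimpleGraph V)
    (hcard : H.edgeSet.ncard + 5 ≤ Fintype.card V) : ∃ r, H.DiamTwoOn Set.univ r := by
  classical
  induction hn : Fintype.card V using Nat.strong_induction_on generalizing V with
  | _ n ih =>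
  subst hn
  have ih' : ∀ (W : Type u) [Fintype W] (G : SimpleGraph W), Fintype.card W < Fintype.card V →
      G.edgeSet.ncard + 5 ≤ Fintype.card W → ∃ r, G.DiamTwoOn Set.univ r :=
    fun W _ G hW hG => ih _ hW G hG rfl
  clear ih
  -- Further edges may be added to `H`.
  obtain ⟨H', hle, hH'⟩ := H.exists_le_ncard_edgeSet_eq (k := Fintype.card V - 5) (by omega) (by
    obtain ⟨m, hm⟩ := Nat.exists_eq_add_of_le' hcard
    rw [hm, ← add_assoc, Nat.choose_succ_left _ _ (by norm_num)]
    simp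
    omega)
  suffices h : ∃ r, H'.DiamTwoOn Set.univ r from h.imp fun r hr => hr.mono hle
  have hcard' : #H'.edgeFinset + 5 = Fintype.card V := by
    rw [Set.ncard_eq_toFinset_card'] at hH'
    change #H'.edgeFinset = _ at hH'
    omega
  clear hle hH' hcard
  rename' H => H₀, H' => H
  clear H₀
  have huniq : ∀ u a b, H.degree u = 1 → H.Adj u a → H.Adj u b → a = b := by
    intro u a b hu ha hb
    rw [← card_neighborFinset_eq_degree] at hu
    exact card_le_one.1 hu.le a (by simpa using ha) b (by simpa using hb)
  -- Two leaves with distinct non-adjacent stems are removed.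
  by_cases hH : ∀ u w v v', H.degree u = 1 → H.degree w = 1 → H.Adj u v → H.Adj w v' → v ≠ v' →
      H.Adj v v'
  swap
  · push Not at hH
    obtain ⟨u, w, v, v', hu, hw, huv, hwv, hvv, hnadj⟩ := hH
    have huw : u ≠ w := by
      rintro rfl
      exact hvv (huniq u v v' hu huv hwv)
    have hvw : v ≠ w := by
      rintro rfl
      exact hnadj (huniq v u v' hw huv.symm hwv ▸ huv.symm)
    have hvu' : v' ≠ u := by
      rintro rfl
      exact hnadj (huniq v' w v hu hwv.symm huv ▸ hwv)
    have hne : s(u, v) ≠ s(w, v') := by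
      simp [huw, hvu'.symm]
    have hA : ({s(u, v), s(w, v')} : Finset (Sym2 V)) ⊆ H.edgeFinset := by
      intro e he
      rcases mem_insert.1 he with rfl | he
      · simpa using huv
      · rw [mem_singleton.1 he]
        simpa using hwv
    have hAcard := card_pair hne
    obtain ⟨r, hr⟩ := exists_diamTwoOn_compl ih' hcard'.le {u, w} (by simp) _ hA
      (by simp) (by rw [card_pair huw, hAcard])
    obtain ⟨r', hr', htot⟩ := hr.exists_total
    have huv' : ∀ a, H.Adj u a ↔ a = v :=
      fun a => ⟨fun ha => huniq u a v hu ha huv, fun ha => ha ▸ huv⟩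
    have hwv' : ∀ a, H.Adj w a ↔ a = v' :=
      fun a => ⟨fun ha => huniq w a v' hw ha hwv, fun ha => ha ▸ hwv⟩
    have hE := card_le_card hA
    have h3 : #(univ : Finset V) - #({u, w, v, v'} : Finset V) ≤ _ := le_card_sdiff _ _
    have h4 : #({u, w, v, v'} : Finset V) ≤ 4 := card_le_four
    rw [card_univ] at h3
    obtain ⟨s, hs, t, ht, hst⟩ := one_lt_card.1
      (show 1 < #((univ : Finset V) \ {u, w, v, v'}) by omega)
    simp only [mem_sdiff, mem_univ, mem_insert, mem_singleton, not_or, true_and] at hs ht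
    rcases htot v (by simp [huv.ne', hvw]) v' (by simp [hvu', hwv.ne']) hvv hnadj with h | h
    · exact hr'.insert_leaves_of_arc (by simp) (by simp) huw
        (fun a => by simp only [Set.mem_ofPred_eq, mem_insert, mem_singleton]; tauto) huv' hwv' h
        (s := s) (t := t) (by simp [hs]) (by simp [ht]) hst hs.2.2.1 hs.2.2.2 ht.2.2.1 ht.2.2.2
    · exact hr'.insert_leaves_of_arc (by simp) (by simp) huw.symm
        (fun a => by simp only [Set.mem_ofPred_eq, mem_insert, mem_singleton]; tauto) hwv' huv' h
        (s := s) (t := t) (by simp [hs]) (by simp [ht]) hst hs.2.2.2 hs.2.2.1 ht.2.2.2 ht.2.2.1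
  obtain ⟨u₁, hu₁, u₂, hu₂, p, hp, q, hq, h12, h1p, h1q, h2p, h2q, hpq⟩ :=
    exists_four_distinct (H.four_le_card_isolated hH hcard'.le)
  have hiso : ∀ x ∈ ({v | H.degree v = 0} : Finset V), ∀ a, ¬ H.Adj x a := by
    intro x hx a hxa
    have := (H.degree_pos_iff_exists_adj x).2 ⟨a, hxa⟩
    simp only [mem_filter_univ] at hx
    omega
  have hne : ∀ x ∈ ({v | H.degree v = 0} : Finset V), ∀ w, 2 ≤ H.degree w → x ≠ w := by
    rintro x hx w hw rfl
    simp only [mem_filter_univ] at hx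
    omega
  -- A vertex of degree at least three is removed together with two isolated vertices.
  by_cases hdeg : ∀ v, H.degree v ≤ 2
  swap
  · push Not at hdeg
    obtain ⟨w, hw⟩ := hdeg
    obtain ⟨r, hr⟩ := exists_diamTwoOn_compl ih' hcard'.le {u₁, u₂, w} (by simp)
      (H.incidenceFinset w) (H.incidenceFinset_subset w)
      (fun e he => ⟨w, ((H.mem_incidenceFinset w e).1 he).2, by simp⟩)
      (card_le_three.trans (by rw [card_incidenceFinset_eq_degree]; omega))
    exact hr.insert_hubs_one (u₁ := u₁) (u₂ := u₂) (w := w) (p := p) (q := q) (by simp) (by simp)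
      (by simp) h12 (hne _ hu₁ w hw.le) (hne _ hu₂ w hw.le)
      (fun a => by simp only [Set.mem_ofPred_eq, mem_insert, mem_singleton]; tauto)
      (hiso _ hu₁) (hiso _ hu₂) (by simp [h1p.symm, h2p.symm, hne _ hp w hw.le])
      (by simp [h1q.symm, h2q.symm, hne _ hq w hw.le]) hpq (fun h => hiso _ hp w h.symm)
      (fun h => hiso _ hq w h.symm)
  by_cases hadj : ∀ v w, H.degree v = 2 → H.degree w = 2 → v ≠ w → H.Adj v w
  · exact H.exists_diamTwoOn_of_irreducible hH hdeg hadj hcard'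
  · -- Two non-adjacent vertices of degree two are removed together with two isolated vertices.
    push Not at hadj
    obtain ⟨w₁, w₂, hw₁, hw₂, hw, hnadj⟩ := hadj
    have hdisj : Disjoint (H.incidenceFinset w₁) (H.incidenceFinset w₂) := by
      rw [Finset.disjoint_left]
      intro e he₁ he₂
      rw [mem_incidenceFinset] at he₁ he₂
      exact hnadj (H.adj_of_mem_incidenceSet hw he₁ he₂)
    obtain ⟨r, hr⟩ := exists_diamTwoOn_compl ih' hcard'.le {u₁, u₂, w₁, w₂} (by simp)
      (H.incidenceFinset w₁ ∪ H.incidenceFinset w₂)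
      (union_subset (H.incidenceFinset_subset w₁) (H.incidenceFinset_subset w₂))
      (fun e he => by
        rcases mem_union.1 he with he | he
        · exact ⟨w₁, ((H.mem_incidenceFinset w₁ e).1 he).2, by simp⟩
        · exact ⟨w₂, ((H.mem_incidenceFinset w₂ e).1 he).2, by simp⟩)
      (card_le_four.trans (by
        rw [Finset.card_union_of_disjoint hdisj, card_incidenceFinset_eq_degree,
          card_incidenceFinset_eq_degree, hw₁, hw₂]))
    exact hr.insert_hubs_two (u₁ := u₁) (u₂ := u₂) (w₁ := w₁) (w₂ := w₂) (p := p) (q := q)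
      (by simp) (by simp) (by simp) (by simp) h12 hw (hne _ hu₁ w₁ hw₁.ge) (hne _ hu₂ w₁ hw₁.ge)
      (hne _ hu₁ w₂ hw₂.ge) (hne _ hu₂ w₂ hw₂.ge)
      (fun a => by simp only [Set.mem_ofPred_eq, mem_insert, mem_singleton]; tauto)
      (hiso _ hu₁) (hiso _ hu₂)
      (by simp [h1p.symm, h2p.symm, hne _ hp w₁ hw₁.ge, hne _ hp w₂ hw₂.ge])
      (by simp [h1q.symm, h2q.symm, hne _ hq w₁ hw₁.ge, hne _ hq w₂ hw₂.ge]) hpq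
      (hiso _ hp) (hiso _ hq)

end SimpleGraph

/-! ### Orientations of diameter two and the extremal graph -/

namespace Digraph

variable {V : Type u} {D : Digraph V}

theorem edist_le_two_iff (hD : ∀ a, ¬ D.Adj a a) {a b : V} :
    D.edist a b ≤ 2 ↔ a = b ∨ D.Adj a b ∨ ∃ c, D.Adj a c ∧ D.Adj c b := by
  constructor
  · intro h
    have h3 : D.edist a b < 3 := lt_of_le_of_lt h (by decide)
    rw [edist, iInf_lt_iff] at h3
    obtain ⟨⟨p, _⟩, hp⟩ := h3
    have hp' : p.length < 3 := by exact_mod_cast hp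
    match p, hp' with
    | .nil _, _ => exact Or.inl rfl
    | .cons h (.nil _), _ => exact Or.inr (Or.inl h)
    | .cons h (.cons h' (.nil _)), _ => exact Or.inr (Or.inr ⟨_, h, h'⟩)
    | .cons _ (.cons _ (.cons _ p)), hp =>
      simp only [Walk.length] at hp
      omega
  · have hle : ∀ p : Walk D a b, p.IsPath → p.length ≤ 2 → D.edist a b ≤ 2 := fun p hp hl =>
      (iInf_le _ (⟨p, hp⟩ : {p : Walk D a b // p.IsPath})).trans (by exact_mod_cast hl)
    by_cases hab : a = b
    · subst hab
      exact fun _ => hle (.nil a) (by simp [Walk.IsPath, Walk.support]) (by simp [Walk.length])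
    · rintro (h | h | ⟨c, h₁, h₂⟩)
      · exact absurd h hab
      · exact hle (.cons h (.nil b)) (by simp [Walk.IsPath, Walk.support, hab])
          (by simp [Walk.length])
      · have hac : a ≠ c := fun h => hD a (by rwa [← h] at h₁)
        have hcb : c ≠ b := fun h => hD b (by rwa [h] at h₂)
        exact hle (.cons h₁ (.cons h₂ (.nil b)))
          (by simp [Walk.IsPath, Walk.support, hab, hac, hcb]) (by simp [Walk.length])

theorem IsOrientation.irrefl {G : SimpleGraph V} (h : D.IsOrientation G) (a : V) : ¬ D.Adj a a :=
  fun ha => G.irrefl (h.1 a a ha)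

theorem IsOrientation.asymm {G : SimpleGraph V} (h : D.IsOrientation G) {a b : V}
    (hab : D.Adj a b) : ¬ D.Adj b a := fun hba => by
  rcases h.2 a b (h.1 a b hab) with h' | h'
  · exact h'.2 hba
  · exact h'.2 hab

/-- The head of an arc is at distance at least two from its tail. -/
theorem IsOrientation.two_le_ediam {G : SimpleGraph V} (h : D.IsOrientation G) {a b : V}
    (hab : D.Adj a b) : 2 ≤ D.ediam := by
  refine le_trans ?_ ((le_iSup (D.edist b) a).trans (le_iSup (fun x => ⨆ y, D.edist x y) b))
  refine le_iInf fun ⟨p, _⟩ => ?_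
  cases p with
  | nil => exact absurd hab (h.irrefl _)
  | cons h' p =>
    cases p with
    | nil => exact absurd h' (h.asymm hab)
    | cons _ p =>
      simp only [Walk.length]
      exact_mod_cast Nat.le_add_left 2 p.length

theorem IsOrientation.ediam_le_two_iff {G : SimpleGraph V} (h : D.IsOrientation G) :
    D.ediam ≤ 2 ↔ ∀ a b, a ≠ b → D.Adj a b ∨ ∃ c, D.Adj a c ∧ D.Adj c b := by
  simp only [ediam, iSup_le_iff, edist_le_two_iff h.irrefl, or_iff_not_imp_left, ne_eq]

end Digraph

namespace SimpleGraph

variable {V : Type u}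

theorem DiamTwoOn.hasOrientationOfDiameterTwo [Nontrivial V] {G : SimpleGraph V}
    {r : V → V → Prop} (h : Gᶜ.DiamTwoOn Set.univ r) : G.HasOrientationOfDiameterTwo := by
  obtain ⟨r', hr', htot⟩ := h.exists_total
  have hD : (⟨r'⟩ : Digraph V).IsOrientation G := by
    constructor
    · intro a b hab
      have hne : a ≠ b := fun h => hr'.asymm a b hab (by subst h; exact hab)
      by_contra hadj
      exact hr'.not_adj a b hab (by simp [hne, hadj])
    · intro a b hab
      rcases htot a trivial b trivial hab.ne (by simp [hab]) with h' | h'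
      · exact Or.inl ⟨h', hr'.asymm _ _ h'⟩
      · exact Or.inr ⟨h', hr'.asymm _ _ h'⟩
  refine ⟨⟨r'⟩, hD, le_antisymm ?_ ?_⟩
  · exact hD.ediam_le_two_iff.2 fun a b hab => hr'.reach a b trivial trivial hab
  · obtain ⟨a, b, hab⟩ := exists_pair_ne V
    rcases hr'.reach a b trivial trivial hab with h' | ⟨c, h', -⟩
    · exact hD.two_le_ediam h'
    · exact hD.two_le_ediam h'

theorem ncard_edgeSet_add_ncard_edgeSet_compl [Fintype V] (G : SimpleGraph V) :
    G.edgeSet.ncard + Gᶜ.edgeSet.ncard = (Fintype.card V).choose 2 := by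
  classical
  rw [← card_edgeFinset_top_eq_card_choose_two, ← Set.ncard_union_eq, ← edgeSet_sup,
    sup_compl_eq_top, Set.ncard_eq_toFinset_card']
  · rfl
  · rw [disjoint_edgeSet]
    exact disjoint_compl_right

theorem hasOrientationOfDiameterTwo_of_le_ncard_edgeSet [Fintype V] (G : SimpleGraph V)
    (hV : 5 ≤ Fintype.card V)
    (hG : (Fintype.card V).choose 2 - Fintype.card V + 5 ≤ G.edgeSet.ncard) :
    G.HasOrientationOfDiameterTwo := by
  have : Nontrivial V := Fintype.one_lt_card_iff_nontrivial.1 (by omega)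
  have h := G.ncard_edgeSet_add_ncard_edgeSet_compl
  obtain ⟨r, hr⟩ := Gᶜ.exists_diamTwoOn_of_ncard_edgeSet_le (by omega)
  exact hr.hasOrientationOfDiameterTwo

theorem ncard_edgeSet_completeAddVertex {W : Type u} [Fintype W] (S : Finset W) :
    (completeAddVertex S).edgeSet.ncard = (Fintype.card W).choose 2 + S.card := by
  classical
  have hinj : Function.Injective fun a : W => s(none, some a) := fun a b h => by simpa using h
  have hinj' : Function.Injective (Sym2.map (some : W → Option W)) :=
    Sym2.map.injective (Option.some_injective W)
  have hset : (completeAddVertex S).edgeSet =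
      Sym2.map some '' (⊤ : SimpleGraph W).edgeSet ∪ (fun a => s(none, some a)) '' S := by
    ext e
    induction e with
    | _ a b =>
      rw [mem_edgeSet]
      constructor
      · intro h
        rcases a with _ | a <;> rcases b with _ | b
        · exact absurd h id
        · exact Or.inr ⟨b, h, rfl⟩
        · exact Or.inr ⟨a, h, Sym2.eq_swap⟩
        · exact Or.inl ⟨s(a, b), h, rfl⟩
      · rintro (⟨e', he', h⟩ | ⟨x, hx, h⟩)
        · induction e' with
          | _ x y =>
            rw [← mem_edgeSet, ← h]
            exact he'
        · rw [← mem_edgeSet, ← h]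
          exact hx
  have hdisj : Disjoint (Sym2.map some '' (⊤ : SimpleGraph W).edgeSet)
      ((fun a => s(none, some a)) '' (S : Set W)) := by
    rw [Set.disjoint_left]
    rintro _ ⟨e', -, rfl⟩ ⟨x, -, h⟩
    have : (none : Option W) ∈ Sym2.map some e' := h ▸ Sym2.mem_mk_left _ _
    obtain ⟨y, -, hy⟩ := Sym2.mem_map.1 this
    exact absurd hy (by simp)
  rw [hset, Set.ncard_union_eq hdisj, Set.ncard_image_of_injective _ hinj',
    Set.ncard_image_of_injective _ hinj, Set.ncard_coe_finset,
    ← card_edgeFinset_top_eq_card_choose_two, Set.ncard_eq_toFinset_card']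
  rfl

/-- In an orientation of diameter two the new vertex has two out-neighbours: if it had only one
out-neighbour `a`, then `a` would dominate the clique, and a vertex `l` outside `S` could not reach
`a` in two steps. -/
theorem exists_two_out_neighbors {W : Type u} {S : Finset W} {r : Option W → Option W → Prop}
    (hr : ∀ x y, r x y → (completeAddVertex S).Adj x y) (hasymm : ∀ x y, r x y → ¬ r y x)
    (hreach : ∀ x y, x ≠ y → r x y ∨ ∃ z, r x z ∧ r z y) {l : W} (hl : l ∉ S) :
    ∃ a ∈ S, ∃ b ∈ S, a ≠ b ∧ r none (some a) ∧ r none (some b) := by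
  have hout : ∀ x, r none x → ∃ a ∈ S, x = some a := by
    rintro (_ | a) h
    · exact absurd (hr _ _ h) id
    · exact ⟨a, hr _ _ h, rfl⟩
  obtain ⟨a, haS, ha⟩ : ∃ a ∈ S, r none (some a) := by
    rcases hreach none (some l) (by simp) with h | ⟨z, h, -⟩
    · exact absurd (hr _ _ h) hl
    · obtain ⟨a, haS, rfl⟩ := hout z h
      exact ⟨a, haS, h⟩
  by_contra hno
  have huniq : ∀ x, r none x → x = some a := by
    intro x hx
    obtain ⟨b, hb, rfl⟩ := hout x hx
    by_contra hne
    exact hno ⟨a, haS, b, hb, fun h => hne (by rw [h]), ha, hx⟩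
  have hdom : ∀ b : W, b ≠ a → r (some a) (some b) := by
    intro b hb
    rcases hreach none (some b) (by simp) with h | ⟨z, h, h'⟩
    · exact absurd (by simpa using huniq _ h) hb
    · rwa [huniq z h] at h'
  have hla : l ≠ a := fun h => hl (h ▸ haS)
  rcases hreach (some l) (some a) (by simpa using hla) with h | ⟨z, h, h'⟩
  · exact hasymm _ _ h (hdom l hla)
  · rcases z with _ | z
    · exact hl (hr _ _ h)
    · by_cases hza : z = a
      · subst hza
        exact hasymm _ _ h (hdom l hla)
      · exact hasymm _ _ h' (hdom z hza)

theorem not_hasOrientationOfDiameterTwo_completeAddVertex {W : Type u} [Fintype W]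
    (S : Finset W) (hS : S.card = 3) (hW : 4 ≤ Fintype.card W) :
    ¬ (completeAddVertex S).HasOrientationOfDiameterTwo := by
  classical
  rintro ⟨D, hD, hdiam⟩
  have hreach := hD.ediam_le_two_iff.1 hdiam.le
  obtain ⟨l, -, hl⟩ : ∃ l ∈ Finset.univ, l ∉ S :=
    Finset.exists_mem_notMem_of_card_lt_card (by rw [Finset.card_univ]; omega)
  obtain ⟨a, ha, b, hb, hab, hDa, hDb⟩ := exists_two_out_neighbors (r := D.Adj) hD.1
    (fun x y => hD.asymm) hreach hl
  -- Reversing all arcs turns in-neighbours into out-neighbours.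
  obtain ⟨c, hc, d, hd, hcd, hDc, hDd⟩ := exists_two_out_neighbors (r := fun x y => D.Adj y x)
    (fun x y h => (hD.1 y x h).symm) (fun x y => hD.asymm)
    (fun x y hxy => (hreach y x hxy.symm).imp_right fun ⟨z, h₁, h₂⟩ => ⟨z, h₂, h₁⟩) hl
  have hac : a ≠ c := fun h => hD.asymm hDa (h ▸ hDc)
  have had : a ≠ d := fun h => hD.asymm hDa (h ▸ hDd)
  have hbc : b ≠ c := fun h => hD.asymm hDb (h ▸ hDc)
  have hbd : b ≠ d := fun h => hD.asymm hDb (h ▸ hDd)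
  have hsub : ({a, b, c, d} : Finset W) ⊆ S := by
    intro x hx
    simp only [Finset.mem_insert, Finset.mem_singleton] at hx
    rcases hx with rfl | rfl | rfl | rfl <;> assumption
  have h4 : ({a, b, c, d} : Finset W).card = 4 := by
    simp [hab, hac, had, hbc, hbd, hcd]
  have := Finset.card_le_card hsub
  omega

end SimpleGraph

/-- Since `5 ≤ n`, we have `n ≤ n.choose 2`, so the subtractions below do not truncate. -/
theorem theorem1 (n : ℕ) (hn : 5 ≤ n) :
    -- every graph of order `n` and size at least `C(n,2) - n + 5` has an orientation of diameter two
    (∀ (V : Type u) [Fintype V] (G : SimpleGraph V), Fintype.card V = n →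
      n.choose 2 - n + 5 ≤ G.edgeSet.ncard → G.HasOrientationOfDiameterTwo) ∧
    -- the extremal graph has one edge less and has no orientation of diameter two
    (∀ (W : Type u) [Fintype W] (S : Finset W), Fintype.card W = n - 1 → S.card = 3 →
      (SimpleGraph.completeAddVertex S).edgeSet.ncard = n.choose 2 - n + 4 ∧
      ¬ (SimpleGraph.completeAddVertex S).HasOrientationOfDiameterTwo) ∧
    -- hence `C(n,2) - n + 5` is the least size that forces an orientation of diameter two
    IsLeast {m : ℕ | ∀ (V : Type u) [Fintype V] (G : SimpleGraph V), Fintype.card V = n →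
        m ≤ G.edgeSet.ncard → G.HasOrientationOfDiameterTwo}
      (n.choose 2 - n + 5) := by
  have hupper : ∀ (V : Type u) [Fintype V] (G : SimpleGraph V), Fintype.card V = n →
      n.choose 2 - n + 5 ≤ G.edgeSet.ncard → G.HasOrientationOfDiameterTwo := by
    rintro V _ G rfl hG
    exact G.hasOrientationOfDiameterTwo_of_le_ncard_edgeSet hn hG
  have hlower : ∀ (W : Type u) [Fintype W] (S : Finset W), Fintype.card W = n - 1 → S.card = 3 →
      (SimpleGraph.completeAddVertex S).edgeSet.ncard = n.choose 2 - n + 4 ∧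
      ¬ (SimpleGraph.completeAddVertex S).HasOrientationOfDiameterTwo := by
    intro W _ S hW hS
    refine ⟨?_, SimpleGraph.not_hasOrientationOfDiameterTwo_completeAddVertex S hS (by omega)⟩
    obtain ⟨m, rfl⟩ := Nat.exists_eq_add_of_le' hn
    have h1 : (m + 5).choose 2 = (m + 4) + (m + 4).choose 2 := by
      rw [Nat.choose_succ_left _ _ (by norm_num)]
      simp
    have h2 : 1 ≤ (m + 4).choose 2 := Nat.choose_pos (by omega)
    rw [SimpleGraph.ncard_edgeSet_completeAddVertex, hW, hS, h1]
    rw [show m + 5 - 1 = m + 4 from rfl]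
    omega
  refine ⟨hupper, hlower, hupper, fun m hm => ?_⟩
  by_contra hlt
  have hcard : Fintype.card (ULift.{u} (Fin (n - 1))) = n - 1 := by simp
  obtain ⟨S, -, hS⟩ := Finset.exists_subset_card_eq
    (s := (Finset.univ : Finset (ULift.{u} (Fin (n - 1))))) (n := 3)
    (by rw [Finset.card_univ]; omega)
  obtain ⟨hedges, hno⟩ := hlower _ S hcard hS
  exact hno (hm _ _ (by rw [Fintype.card_option, hcard]; omega) (by omega))
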